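/- A complex measure on $\mathbb R$ is a complex-valued set function on the bounded Borel subsets of $\mathbb R$ that is countably additive on every disjoint sequence of Borel sets with bounded union; $|\mu|$ denotes its variation, a positive Borel measure on $\mathbb R$. A set $E\subset\mathbb R$ is called discrete if its intersection with every ball is finite. A (complex or positive, finite on bounded sets) measure is called a tempered distribution if the functional $\varphi\mapsto\int\varphi\,d\mu$ on smooth compactly supported functions extends to a continuous linear functional on the Schwartz space $\mathcal S(\mathbb R)$; the Fourier transform of a tempered distribution $f$ is $\hat f(\varphi)=f(\hat\varphi)$, where $\hat\varphi(t)=\int_{\mathbb R}\varphi(x)e^{-2\pi i xt}\,dx$. A complex measure $\mu$ on $\mathbb R$ with discrete support is crystalline if $\mu$ is a tempered distribution and its Fourier transform $\hat\mu$ is also a complex measure with discrete support. A crystalline measure $\mu$ is a Fourier quasicrystal if, in addition, the measures $|\mu|$ and $|\hat\mu|$ are tempered distributions. **Theorem.** There is a crystalline measure on $\mathbb R$ that is not a Fourier quasicrystal. More precisely, there is a crystalline measure $\mu$ on $\mathbb R$ such that $|\mu|$ is not a tempered distribution; in particular $\mu$ is not a Fourier quasicrystal. -/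

import Mathlib

open MeasureTheory Set Bornology
open scoped SchwartzMap FourierTransform ENNReal

/-- A complex (Radon) measure on `ℝ`, not necessarily of finite total mass: a complex-valued
set function on the bounded Borel sets which is countably additive, in the sense that
`μ (⋃ i, s i) = ∑ i, μ (s i)` for pairwise disjoint Borel sets `s i` with bounded union.
As for `VectorMeasure`, the set function is extended by `0` to all other sets. -/
structure LocalComplexMeasure where
  /-- The value on a set. -/
  toFun : Set ℝ → ℂ
  empty' : toFun ∅ = 0
  not_measurable' : ∀ s, ¬ MeasurableSet s → toFun s = 0
  not_bounded' : ∀ s, ¬ IsBounded s → toFun s = 0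
  hasSum_iUnion' : ∀ s : ℕ → Set ℝ, (∀ i, MeasurableSet (s i)) →
    Pairwise (Function.onFun Disjoint s) → IsBounded (⋃ i, s i) →
    HasSum (fun i => toFun (s i)) (toFun (⋃ i, s i))

namespace LocalComplexMeasure

instance : CoeFun LocalComplexMeasure (fun _ => Set ℝ → ℂ) := ⟨toFun⟩

theorem isSigmaSubadditiveSetFun_enorm (μ : LocalComplexMeasure) :
    IsSigmaSubadditiveSetFun (fun s => ‖μ s‖ₑ) := by
  intro s hs
  by_cases hb : IsBounded (⋃ i, (s i).val)
  · have h := μ.hasSum_iUnion' (fun i => (s i).val) (fun i => (s i).prop) hs hb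
    simpa [h.tsum_eq] using enorm_tsum_le_tsum_enorm (f := fun i => μ (s i).val)
  · simp [μ.not_bounded' _ hb]

/-- The variation `|μ|`, a positive Borel measure: `|μ|(E)` is the supremum of `∑ i, ‖μ (E i)‖`
over the finite partitions of the Borel set `E` into Borel sets `E i`. (Unbounded parts `E i`
contribute `0` to the sum, so only the bounded parts count.) -/
noncomputable def variation (μ : LocalComplexMeasure) : Measure ℝ :=
  preVariation (fun s => ‖μ s‖ₑ) μ.isSigmaSubadditiveSetFun_enorm (by simp [μ.empty'])

/-- The support of `μ`: the points all of whose neighbourhoods have positive `|μ|`-measure. -/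
def support (μ : LocalComplexMeasure) : Set ℝ := μ.variation.support

/-- The restriction of `μ` to a bounded Borel set `B`, a finite complex measure. -/
noncomputable def restrict (μ : LocalComplexMeasure) (B : Set ℝ) (hB : IsBounded B) (hB' : MeasurableSet B) :
    ComplexMeasure ℝ where
  measureOf' s := open scoped Classical in if MeasurableSet s then μ (s ∩ B) else 0
  empty' := by simp [μ.empty']
  not_measurable' s hs := by simp [hs]
  m_iUnion' s hs hd := by
    have h := μ.hasSum_iUnion' (fun i => s i ∩ B) (fun i => (hs i).inter hB')
      (fun i j hij => (hd hij).mono inter_subset_left inter_subset_left)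
      (hB.subset (iUnion_subset fun i => inter_subset_right))
    rw [← iUnion_inter] at h
    simpa [hs, MeasurableSet.iUnion hs] using h

/-- The integral `∫ φ dμ` of a compactly supported function `φ`. -/
noncomputable def integral (μ : LocalComplexMeasure) (φ : ℝ → ℂ) (hφ : HasCompactSupport φ) : ℂ :=
  (μ.restrict (tsupport φ) hφ.isCompact.isBounded (isClosed_tsupport φ).measurableSet).integral
    φ (ContinuousLinearMap.mul ℝ ℂ)

/-- The tempered distribution `T` is (given by) the complex measure `μ`: both agree on all smooth
compactly supported functions. Since these are dense in `𝓢(ℝ, ℂ)`, there is at most one such `T`;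
it need not be given by an absolutely convergent integral on all of `𝓢(ℝ, ℂ)`. -/
def Represents (μ : LocalComplexMeasure) (T : 𝓢'(ℝ, ℂ)) : Prop :=
  ∀ (φ : 𝓢(ℝ, ℂ)) (hφ : HasCompactSupport φ), T φ = μ.integral φ hφ

/-- `μ` is a tempered distribution and its distributional Fourier transform is the measure `ν`.
Here `𝓕 T φ = T (𝓕 φ)` and `𝓕 φ t = ∫ φ x * exp (-2 π i x t) dx`. -/
def HasFourierTransform (μ ν : LocalComplexMeasure) : Prop :=
  ∃ T : 𝓢'(ℝ, ℂ), μ.Represents T ∧ ν.Represents (𝓕 T)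

end LocalComplexMeasure

/-- A positive measure, finite on bounded sets, is a tempered distribution: the functional
`φ ↦ ∫ φ dν` on smooth compactly supported functions extends to a continuous linear functional on
`𝓢(ℝ, ℂ)`. -/
def IsTemperedMeasure (ν : Measure ℝ) : Prop :=
  ∃ T : 𝓢'(ℝ, ℂ), ∀ φ : 𝓢(ℝ, ℂ), HasCompactSupport φ → T φ = ∫ x, φ x ∂ν

/-- A set is discrete if its intersection with every ball is finite. -/
def IsDiscreteSet (E : Set ℝ) : Prop :=
  ∀ (x r : ℝ), (E ∩ Metric.ball x r).Finite

namespace LocalComplexMeasure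

/-- A crystalline measure: a complex measure with discrete support which is a tempered distribution
and whose Fourier transform is also a measure with discrete support. -/
def IsCrystalline (μ : LocalComplexMeasure) : Prop :=
  IsDiscreteSet μ.support ∧
    ∃ ν : LocalComplexMeasure, μ.HasFourierTransform ν ∧ IsDiscreteSet ν.support

/-- A Fourier quasicrystal: a crystalline measure `μ`, with Fourier transform `ν`, such that `|μ|`
and `|ν|` are tempered distributions. -/
def IsFourierQuasicrystal (μ : LocalComplexMeasure) : Prop :=
  μ.IsCrystalline ∧ IsTemperedMeasure μ.variation ∧
    ∃ ν : LocalComplexMeasure, μ.HasFourierTransform ν ∧ IsTemperedMeasure ν.variation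

end LocalComplexMeasure

/-!
The measure is assembled from atomic measures with explicit control of both sides of the Fourier
transform.

For each `n` there is a crystalline measure `∑ u n x • δ_x` with Fourier transform
`∑ v n ξ • δ_ξ` such that both `u n` and `v n` vanish on `[-n, n]`, while `u n (n + 1) ≠ 0`
(`exists_crystalPair_vanishing`). Indeed, by Poisson's formula, a Dirac comb of spacing
`1 / (2 (n + 1))`, modulated by the frequency `n + 1`, has its Fourier transform on the odd
multiples of `n + 1`. The finitely many atoms of the comb in `[-n, n]` are then removed by
multiplying with trigonometric polynomials of very low frequency, which displaces the atoms of the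
Fourier transform only slightly (`CrystalPair.exists_eq_zero_on_finset`).

Replace `u n` by its difference quotient `(u n x - u n (x - ε n)) / ε n` with a tiny step `ε n`.
Paired with a Schwartz function `φ`, it is controlled by `φ'`, uniformly in the step; so, after a
normalization of `u n` independent of `ε n`, the sum over `n` converges to a tempered distribution
`T` (`exists_temperedDistribution_tsum_diffQuot`). On the Fourier side the difference quotient is
multiplication of `v n` by `(1 - exp (-2 π i ε ξ)) / ε`, which does not enlarge the support. Since the
`n`-th terms live outside balls whose radius tends to infinity, `T` and `𝓕 T` are both measures with
discrete support (`represents_ofWeights_tsum`).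

The variation, however, sees the individual atoms `± u n x / ε n`. The atoms of `u n` are rational
and the steps are irrational with irrational differences, so nothing cancels at `n + 1 + ε n`
(`tsum_diffQuot_add_step`), and for `ε n` small enough the mass there exceeds `(n + 3) ^ n`. The
atoms of a tempered positive measure grow at most polynomially
(`IsTemperedMeasure.exists_real_singleton_le`), so the variation is not tempered.
-/

/-! ### Discrete sets and purely atomic measures -/

namespace IsDiscreteSet

theorem mono {E F : Set ℝ} (hF : IsDiscreteSet F) (h : E ⊆ F) : IsDiscreteSet E :=
  fun x r => (hF x r).subset (inter_subset_inter_left _ h)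

theorem finite_inter {E B : Set ℝ} (hE : IsDiscreteSet E) (hB : IsBounded B) :
    (E ∩ B).Finite := by
  obtain ⟨r, hr⟩ := hB.subset_ball 0
  exact (hE 0 r).subset (inter_subset_inter_right _ hr)

theorem union {E F : Set ℝ} (hE : IsDiscreteSet E) (hF : IsDiscreteSet F) :
    IsDiscreteSet (E ∪ F) := fun x r => by
  rw [union_inter_distrib_right]
  exact (hE x r).union (hF x r)

theorem preimage_sub_const {E : Set ℝ} (hE : IsDiscreteSet E) (t : ℝ) :
    IsDiscreteSet ((fun x => x - t) ⁻¹' E) := fun x r => by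
  refine ((hE (x - t) r).preimage (sub_left_injective (b := t)).injOn).subset ?_
  rintro y ⟨hy, hyr⟩
  refine ⟨hy, ?_⟩
  simpa [Real.dist_eq] using hyr

end IsDiscreteSet

namespace LocalComplexMeasure

theorem enorm_le_variation (μ : LocalComplexMeasure) {E : Set ℝ} (hE : MeasurableSet E) :
    ‖μ E‖ₑ ≤ μ.variation E := by
  by_cases hE' : (⟨E, hE⟩ : Subtype MeasurableSet) = ⊥
  · have : E = ∅ := congrArg Subtype.val hE'
    simp [this, μ.empty']
  simp only [variation, preVariation, VectorMeasure.ennrealToMeasure_apply hE,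
    ennrealPreVariation_apply]
  calc
    ‖μ E‖ₑ = ∑ p ∈ (Finpartition.indiscrete hE').parts, ‖μ p‖ₑ := by simp
    _ ≤ preVariationFun (fun s => ‖μ s‖ₑ) E := by apply preVariation.sum_le

theorem variation_le_of_forall_enorm_le (μ : LocalComplexMeasure) {m : Measure ℝ}
    (h : ∀ E, MeasurableSet E → ‖μ E‖ₑ ≤ m E) : μ.variation ≤ m := by
  refine Measure.le_intro fun s hs _ => ?_
  simp only [variation, preVariation, VectorMeasure.ennrealToMeasure_apply hs,
    ennrealPreVariation_apply, preVariationFun, hs, dite_true, iSup_le_iff]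
  intro i
  calc
    ∑ x ∈ i.parts, ‖μ x‖ₑ ≤ ∑ x ∈ i.parts, m x := Finset.sum_le_sum fun s _ => h s s.property
    _ = m (i.parts.sup Subtype.val) := by
      rw [Finset.sup_set_eq_biUnion]
      refine (MeasureTheory.measure_biUnion_finset ?_ fun b _ => b.property).symm
      intro a ha b hb hab
      simpa [disjoint_iff, Subtype.ext_iff] using i.disjoint ha hb hab
    _ ≤ m s := by
      rw [Finset.sup_set_eq_biUnion]
      exact measure_mono <| iUnion₂_subset fun _ hp => Subtype.coe_le_coe.mpr (i.le hp)

open scoped Classical in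
/-- The purely atomic measure `∑ x, W x • δ_x`, for a weight function `W` which vanishes off a
discrete set. -/
noncomputable def ofWeights (W : ℝ → ℂ) (hW : IsDiscreteSet (Function.support W)) :
    LocalComplexMeasure where
  toFun s := if MeasurableSet s ∧ IsBounded s then ∑' x, s.indicator W x else 0
  empty' := by simp
  not_measurable' s hs := by simp [hs]
  not_bounded' s hs := by simp [hs]
  hasSum_iUnion' s hs hd hb := by
    have hbi (i : ℕ) : IsBounded (s i) := hb.subset (subset_iUnion s i)
    simp only [hs, hbi, hb, MeasurableSet.iUnion hs, and_self, if_true]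
    have hfin := hW.finite_inter hb
    have key (t : Set ℝ) (ht : t ⊆ ⋃ i, s i) :
        ∑' x, t.indicator W x = ∑ x ∈ hfin.toFinset, t.indicator W x := by
      refine tsum_eq_sum fun x hx => ?_
      by_contra hne
      rw [← Ne, indicator_apply_ne_zero] at hne
      exact hx (hfin.mem_toFinset.2 ⟨hne.2, ht hne.1⟩)
    rw [key _ subset_rfl]
    simp_rw [fun i => key (s i) (subset_iUnion s i)]
    refine hasSum_sum fun x _ => ?_
    by_cases hx : x ∈ ⋃ i, s i
    · obtain ⟨i, hi⟩ := mem_iUnion.1 hx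
      have : (⋃ i, s i).indicator W x = (s i).indicator W x := by
        rw [indicator_of_mem hx, indicator_of_mem hi]
      rw [this]
      refine hasSum_single i fun j hj => indicator_of_notMem (fun hxj => ?_) _
      exact (hd hj).le_bot ⟨hxj, hi⟩
    · have (i : ℕ) : (s i).indicator W x = 0 :=
        indicator_of_notMem (fun h => hx (mem_iUnion.2 ⟨i, h⟩)) _
      simp [this, indicator_of_notMem hx]

variable {W : ℝ → ℂ} {hW : IsDiscreteSet (Function.support W)}

theorem ofWeights_apply {s : Set ℝ} (hs : MeasurableSet s) (hb : IsBounded s) :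
    ofWeights W hW s = ∑' x, s.indicator W x :=
  if_pos ⟨hs, hb⟩

theorem ofWeights_singleton (x : ℝ) : ofWeights W hW {x} = W x := by
  rw [ofWeights_apply (measurableSet_singleton x) isBounded_singleton, tsum_eq_single x]
  · simp
  · intro y hy
    simp [hy]

theorem ofWeights_eq_sum {s : Set ℝ} (hs : MeasurableSet s) {F : Finset ℝ}
    (hb : IsBounded s) (hF : ∀ x ∈ s, W x ≠ 0 → x ∈ F) :
    ofWeights W hW s = ∑ x ∈ F, s.indicator W x := by
  rw [ofWeights_apply hs hb]
  refine tsum_eq_sum fun x hx => ?_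
  by_contra hne
  rw [← Ne, indicator_apply_ne_zero] at hne
  exact hx (hF x hne.1 hne.2)

theorem variation_ofWeights_le :
    (ofWeights W hW).variation ≤ Measure.sum fun x : ℝ => ‖W x‖ₑ • Measure.dirac x := by
  refine variation_le_of_forall_enorm_le _ fun E hE => ?_
  rw [Measure.sum_apply _ hE]
  by_cases hb : IsBounded E
  · rw [ofWeights_apply hE hb]
    refine enorm_tsum_le_tsum_enorm.trans (ENNReal.tsum_le_tsum fun x => ?_)
    by_cases hx : x ∈ E <;> simp [hx, hE]
  · simp [(ofWeights W hW).not_bounded' E hb]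

theorem variation_ofWeights_lt_top {B : Set ℝ} (hB : IsBounded B) :
    (ofWeights W hW).variation B < ∞ := by
  obtain ⟨r, hr⟩ := hB.subset_ball 0
  refine (measure_mono hr).trans_lt ((variation_ofWeights_le _).trans_lt ?_)
  rw [Measure.sum_apply _ measurableSet_ball,
    tsum_eq_sum (s := (hW 0 r).toFinset)]
  · refine ENNReal.sum_lt_top.2 fun x _ => ?_
    simp only [Measure.smul_apply, smul_eq_mul]
    finiteness
  · intro x hx
    by_cases hxr : x ∈ Metric.ball (0 : ℝ) r
    · have : W x = 0 := by
        by_contra h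
        exact hx ((hW 0 r).mem_toFinset.2 ⟨h, hxr⟩)
      simp [this]
    · simp [measurableSet_ball, indicator_of_notMem hxr]

theorem support_ofWeights_subset : (ofWeights W hW).support ⊆ Function.support W := by
  intro x hx
  by_contra hWx
  have hfin := hW x 1
  have hU : Metric.ball x 1 \ (Function.support W ∩ Metric.ball x 1) ∈ nhds x := by
    refine (Metric.isOpen_ball.sdiff hfin.isClosed).mem_nhds ⟨by simp, fun h => hWx h.1⟩
  have hpos := (Measure.mem_support_iff_forall x).1 hx _ hU
  refine hpos.not_ge ((variation_ofWeights_le _).trans ?_)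
  have hm : MeasurableSet (Metric.ball x 1 \ (Function.support W ∩ Metric.ball x 1)) :=
    measurableSet_ball.diff hfin.measurableSet
  rw [Measure.sum_apply _ hm]
  refine (ENNReal.tsum_eq_zero.2 fun y => ?_).le
  by_cases hy : W y = 0
  · simp [hy]
  · simp only [Measure.smul_apply, Measure.dirac_apply' _ hm, smul_eq_mul]
    rw [indicator_of_notMem, mul_zero]
    exact fun h => h.2 ⟨hy, h.1⟩

theorem isDiscreteSet_support_ofWeights : IsDiscreteSet (ofWeights W hW).support :=
  hW.mono support_ofWeights_subset

theorem integral_ofWeights {φ : ℝ → ℂ} (hφ : HasCompactSupport φ) :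
    (ofWeights W hW).integral φ hφ = ∑' x, W x * φ x := by
  have hb : IsBounded (tsupport φ) := hφ.isCompact.isBounded
  have hfin := hW.finite_inter hb
  have hres : (ofWeights W hW).restrict (tsupport φ) hb (isClosed_tsupport φ).measurableSet =
      ∑ x ∈ hfin.toFinset, VectorMeasure.dirac x (W x) := by
    ext s hs : 1
    have h1 : (ofWeights W hW).restrict (tsupport φ) hb (isClosed_tsupport φ).measurableSet s =
        ofWeights W hW (s ∩ tsupport φ) := if_pos hs
    rw [h1, ofWeights_eq_sum (hs.inter (isClosed_tsupport φ).measurableSet)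
      (hb.subset inter_subset_right) (F := hfin.toFinset)
      (fun x hx hWx => hfin.mem_toFinset.2 ⟨hWx, hx.2⟩), FunLike.coe_sum, Finset.sum_apply]
    refine Finset.sum_congr rfl fun x hx => ?_
    have hxφ : x ∈ tsupport φ := (hfin.mem_toFinset.1 hx).2
    by_cases hxs : x ∈ s <;> simp [hxs, hxφ, hs]
  rw [LocalComplexMeasure.integral, hres, VectorMeasure.integral_finsetSum_vectorMeasure]
  · simp only [VectorMeasure.integral_dirac]
    rw [tsum_eq_sum (s := hfin.toFinset)]
    · simp [mul_comm]
    · intro x hx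
      by_contra h
      exact hx (hfin.mem_toFinset.2 ⟨left_ne_zero_of_mul h,
        subset_tsupport _ (right_ne_zero_of_mul h)⟩)
  · intro x _
    rw [VectorMeasure.Integrable, VectorMeasure.variation_dirac]
    exact (integrable_dirac (by simp)).smul_measure (by simp)

end LocalComplexMeasure

/-! ### Atoms of tempered positive measures -/

/-- Translating a Schwartz function by `a` increases each continuous seminorm at most polynomially
in `a`. -/
theorem SchwartzMap.exists_sup_seminorm_compSubConstCLM_le (s : Finset (ℕ × ℕ)) (χ : 𝓢(ℝ, ℂ)) :
    ∃ (K : ℕ) (M : ℝ), 0 ≤ M ∧ ∀ a : ℝ,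
      s.sup (schwartzSeminormFamily ℂ ℝ ℂ) (χ.compSubConstCLM ℂ a) ≤ M * (1 + |a|) ^ K := by
  let N (i : ℕ × ℕ) : ℝ :=
    2 ^ i.1 * (Finset.Iic i).sup (fun m => SchwartzMap.seminorm ℂ m.1 m.2) χ
  have hN (i : ℕ × ℕ) : 0 ≤ N i := mul_nonneg (by positivity) (apply_nonneg _ _)
  have hsum : 0 ≤ ∑ i ∈ s, N i := Finset.sum_nonneg fun i _ => hN i
  refine ⟨∑ i ∈ s, i.1, ∑ i ∈ s, N i, hsum, fun a => ?_⟩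
  refine Seminorm.finset_sup_apply_le (by positivity) fun i hi => ?_
  refine SchwartzMap.seminorm_le_bound ℂ _ _ _ (by positivity) fun x => ?_
  have h1 : iteratedFDeriv ℝ i.2 (χ.compSubConstCLM ℂ a) x = iteratedFDeriv ℝ i.2 χ (x - a) :=
    iteratedFDeriv_comp_sub i.2 a x
  have h2 := SchwartzMap.one_add_le_sup_seminorm_apply (𝕜 := ℂ) (m := i) le_rfl le_rfl χ (x - a)
  have h3 : ‖x‖ ≤ (1 + |a|) * (1 + ‖x - a‖) := by
    have := abs_add_le (x - a) a
    simp only [sub_add_cancel, Real.norm_eq_abs] at this ⊢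
    nlinarith [abs_nonneg a, abs_nonneg (x - a)]
  have hexp : i.1 ≤ ∑ i ∈ s, i.1 := Finset.single_le_sum (f := Prod.fst) (by simp) hi
  calc ‖x‖ ^ i.1 * ‖iteratedFDeriv ℝ i.2 (χ.compSubConstCLM ℂ a) x‖
      ≤ ((1 + |a|) * (1 + ‖x - a‖)) ^ i.1 * ‖iteratedFDeriv ℝ i.2 χ (x - a)‖ := by
        rw [h1]; gcongr
    _ = (1 + |a|) ^ i.1 * ((1 + ‖x - a‖) ^ i.1 * ‖iteratedFDeriv ℝ i.2 χ (x - a)‖) := by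
        rw [mul_pow, mul_assoc]
    _ ≤ (1 + |a|) ^ (∑ i ∈ s, i.1) * ∑ i ∈ s, N i := by
        gcongr
        · linarith [abs_nonneg a]
        · exact h2.trans (Finset.single_le_sum (f := N) (fun i _ => hN i) hi)
    _ = _ := by ring

/-- The atoms of a tempered positive measure grow at most polynomially: test the measure against
the translates of one bump function. -/
theorem IsTemperedMeasure.exists_real_singleton_le {ν : Measure ℝ} (hν : IsTemperedMeasure ν)
    (hfin : ∀ B, IsBounded B → ν B < ∞) :
    ∃ (K : ℕ) (C : ℝ), ∀ a : ℝ, ν.real {a} ≤ C * (1 + |a|) ^ K := by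
  obtain ⟨T, hT⟩ := hν
  let b : ContDiffBump (0 : ℝ) := default
  let f : ℝ → ℂ := fun x => (b x : ℂ)
  have hfc : HasCompactSupport f := b.hasCompactSupport.comp_left (g := Complex.ofReal) (by simp)
  have hfs : ContDiff ℝ (⊤ : ℕ∞) f := Complex.ofRealCLM.contDiff.comp b.contDiff
  let χ : 𝓢(ℝ, ℂ) := hfc.toSchwartzMap hfs
  have hχ (x : ℝ) : χ x = (b x : ℂ) := rfl
  let q : Seminorm ℂ 𝓢(ℝ, ℂ) := (normSeminorm ℂ ℂ).comp T.toLinearMap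
  have hq : Continuous q := continuous_norm.comp T.continuous
  obtain ⟨s, C, -, hC⟩ := Seminorm.bound_of_continuous (schwartz_withSeminorms ℂ ℝ ℂ) q hq
  obtain ⟨K, M, hM, hKM⟩ := SchwartzMap.exists_sup_seminorm_compSubConstCLM_le s χ
  refine ⟨K, C * M, fun a => ?_⟩
  have hcomp : HasCompactSupport (χ.compSubConstCLM ℂ a) :=
    hfc.comp_homeomorph (Homeomorph.subRight a)
  have hTa := hT _ hcomp
  have hint : ∫ x, (χ.compSubConstCLM ℂ a) x ∂ν = ((∫ x, b (x - a) ∂ν : ℝ) : ℂ) := by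
    rw [← integral_complex_ofReal]
    rfl
  have hbc : HasCompactSupport fun x => b (x - a) :=
    b.hasCompactSupport.comp_homeomorph (Homeomorph.subRight a)
  have : IsFiniteMeasureOnCompacts ν := ⟨fun _ hK => hfin _ hK.isBounded⟩
  have hbi : Integrable (fun x => b (x - a)) ν :=
    (b.continuous.comp (continuous_sub_right a)).integrable_of_hasCompactSupport hbc
  have hle : ν.real {a} ≤ ∫ x, b (x - a) ∂ν := by
    calc ν.real {a} = ∫ x, ({a} : Set ℝ).indicator (fun _ => (1 : ℝ)) x ∂ν := by
          rw [integral_indicator_const _ (measurableSet_singleton a)]; simp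
      _ ≤ ∫ x, b (x - a) ∂ν := by
          refine integral_mono_of_nonneg ?_ hbi ?_
          · exact .of_forall fun x => indicator_nonneg (by simp) x
          · refine .of_forall fun x => ?_
            by_cases hx : x = a
            · have h1 : b 0 = 1 := b.one_of_mem_closedBall (by simpa using b.rIn_pos.le)
              simp [hx, h1]
            · simpa [hx] using b.nonneg
  calc ν.real {a} ≤ ∫ x, b (x - a) ∂ν := hle
    _ ≤ ‖((∫ x, b (x - a) ∂ν : ℝ) : ℂ)‖ := by
        rw [Complex.norm_real]; exact Real.le_norm_self _
    _ = q (χ.compSubConstCLM ℂ a) := by rw [← hint, ← hTa]; rfl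
    _ ≤ C * s.sup (schwartzSeminormFamily ℂ ℝ ℂ) (χ.compSubConstCLM ℂ a) := hC _
    _ ≤ C * (M * (1 + |a|) ^ K) := by gcongr; exact hKM a
    _ = _ := by ring

/-! ### Pairs of weight functions related by the Fourier transform -/

theorem one_add_sq_add_le (x t : ℝ) : 1 + (x + t) ^ 2 ≤ 2 * (1 + t ^ 2) * (1 + x ^ 2) := by
  nlinarith [sq_nonneg (x - t), sq_nonneg (x * t), sq_nonneg x, sq_nonneg t]

theorem SchwartzMap.exists_norm_le_inv_one_add_sq (φ : 𝓢(ℝ, ℂ)) :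
    ∃ C : ℝ, 0 ≤ C ∧ ∀ x, ‖φ x‖ ≤ C * (1 + x ^ 2)⁻¹ := by
  refine ⟨SchwartzMap.seminorm ℂ 0 0 φ + SchwartzMap.seminorm ℂ 2 0 φ,
    add_nonneg (apply_nonneg _ _) (apply_nonneg _ _), fun x => ?_⟩
  rw [← div_eq_mul_inv, le_div_iff₀ (by positivity)]
  have h0 := SchwartzMap.norm_le_seminorm ℂ φ x
  have h2 := SchwartzMap.norm_pow_mul_le_seminorm ℂ φ 2 x
  rw [Real.norm_eq_abs, sq_abs] at h2
  linarith

/-- A weight function whose mass grows slowly enough for `∑ x, u x * φ x` to converge for each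
Schwartz function `φ`. -/
def SlowlyGrowing (u : ℝ → ℂ) : Prop := Summable fun x => ‖u x‖ * (1 + x ^ 2)⁻¹

namespace SlowlyGrowing

variable {u v : ℝ → ℂ}

theorem summable_mul (hu : SlowlyGrowing u) (φ : 𝓢(ℝ, ℂ)) : Summable fun x => u x * φ x := by
  obtain ⟨C, hC0, hC⟩ := φ.exists_norm_le_inv_one_add_sq
  refine Summable.of_norm_bounded (hu.mul_left C) fun x => ?_
  rw [norm_mul]
  calc ‖u x‖ * ‖φ x‖ ≤ ‖u x‖ * (C * (1 + x ^ 2)⁻¹) := by gcongr; exact hC x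
    _ = _ := by ring

theorem add (hu : SlowlyGrowing u) (hv : SlowlyGrowing v) : SlowlyGrowing fun x => u x + v x := by
  refine Summable.of_nonneg_of_le (fun x => by positivity) (fun x => ?_) (Summable.add hu hv)
  rw [← add_mul]
  gcongr
  exact norm_add_le _ _

theorem of_norm_le {c : ℝ} (hu : SlowlyGrowing u) (h : ∀ x, ‖v x‖ ≤ c * ‖u x‖) :
    SlowlyGrowing v := by
  refine Summable.of_nonneg_of_le (fun x => by positivity) (fun x => ?_) (Summable.mul_left c hu)
  rw [← mul_assoc]
  gcongr
  exact h x

theorem comp_sub_const (hu : SlowlyGrowing u) (t : ℝ) : SlowlyGrowing fun x => u (x - t) := by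
  refine (Equiv.addRight t).summable_iff.1 ?_
  refine Summable.of_nonneg_of_le (fun x => by simp only [Function.comp_apply]; positivity)
    (fun x => ?_) (Summable.mul_left (2 * (1 + t ^ 2)) hu)
  simp only [Function.comp_apply, Equiv.coe_addRight, add_sub_cancel_right]
  rw [mul_left_comm]
  gcongr
  rw [← div_eq_mul_inv, inv_le_comm₀ (by positivity) (by positivity), inv_div,
    div_le_iff₀ (by positivity)]
  have := one_add_sq_add_le (x + t) (-t)
  simp only [add_neg_cancel_right, neg_sq] at this
  linarith

end SlowlyGrowing

theorem SchwartzMap.fourier_compSubConstCLM (φ : 𝓢(ℝ, ℂ)) (a ξ : ℝ) :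
    𝓕 (φ.compSubConstCLM ℂ a) ξ = 𝐞 (-(a * ξ)) * 𝓕 φ ξ := by
  rw [SchwartzMap.fourier_coe, SchwartzMap.fourier_coe, Real.fourier_real_eq, Real.fourier_real_eq,
    ← integral_const_mul]
  rw [← integral_add_right_eq_self (μ := volume) _ a]
  refine integral_congr_ae (.of_forall fun x => ?_)
  simp only [SchwartzMap.compSubConstCLM_apply, add_sub_cancel_right, Circle.smul_def, smul_eq_mul]
  rw [← mul_assoc, ← Circle.coe_mul, ← AddChar.map_add_eq_mul]
  congr 3
  ring

theorem SchwartzMap.fourierInv_compSubConstCLM (φ : 𝓢(ℝ, ℂ)) (a x : ℝ) :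
    𝓕⁻ (φ.compSubConstCLM ℂ a) x = 𝐞 (a * x) * 𝓕⁻ φ x := by
  have h (ψ : 𝓢(ℝ, ℂ)) : 𝓕⁻ ψ x = 𝓕 ψ (-x) := by
    rw [SchwartzMap.fourierInv_coe, SchwartzMap.fourier_coe, Real.fourierInv_eq_fourier_neg]
  rw [h, h, fourier_compSubConstCLM]
  simp

/-- The atomic measures `∑ x, u x • δ_x` and `∑ ξ, v ξ • δ_ξ` are of moderate growth, have discrete
supports, and the second one is the Fourier transform of the first one. -/
structure CrystalPair (u v : ℝ → ℂ) : Prop where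
  slow_left : SlowlyGrowing u
  slow_right : SlowlyGrowing v
  discrete_left : IsDiscreteSet (Function.support u)
  discrete_right : IsDiscreteSet (Function.support v)
  tsum_fourier : ∀ φ : 𝓢(ℝ, ℂ), ∑' x, u x * 𝓕 φ x = ∑' ξ, v ξ * φ ξ

namespace CrystalPair

variable {u v u' v' : ℝ → ℂ}

theorem add (h : CrystalPair u v) (h' : CrystalPair u' v') :
    CrystalPair (fun x => u x + u' x) (fun ξ => v ξ + v' ξ) where
  slow_left := h.slow_left.add h'.slow_left
  slow_right := h.slow_right.add h'.slow_right
  discrete_left := (h.discrete_left.union h'.discrete_left).mono (Function.support_add u u')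
  discrete_right := (h.discrete_right.union h'.discrete_right).mono (Function.support_add v v')
  tsum_fourier φ := by
    simp only [add_mul]
    rw [(h.slow_left.summable_mul _).tsum_add (h'.slow_left.summable_mul _),
      (h.slow_right.summable_mul _).tsum_add (h'.slow_right.summable_mul _),
      h.tsum_fourier, h'.tsum_fourier]

theorem const_mul (h : CrystalPair u v) (c : ℂ) :
    CrystalPair (fun x => c * u x) (fun ξ => c * v ξ) where
  slow_left := h.slow_left.of_norm_le fun x => (norm_mul c (u x)).le
  slow_right := h.slow_right.of_norm_le fun x => (norm_mul c (v x)).le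
  discrete_left := h.discrete_left.mono fun _ hx => right_ne_zero_of_mul hx
  discrete_right := h.discrete_right.mono fun _ hx => right_ne_zero_of_mul hx
  tsum_fourier φ := by simp only [mul_assoc, tsum_mul_left, h.tsum_fourier]

theorem translate (h : CrystalPair u v) (t : ℝ) :
    CrystalPair (fun x => u (x - t)) (fun ξ => 𝐞 (-(t * ξ)) * v ξ) where
  slow_left := h.slow_left.comp_sub_const t
  slow_right := h.slow_right.of_norm_le (c := 1) fun x => by
    rw [norm_mul, Circle.norm_coe]
  discrete_left := h.discrete_left.preimage_sub_const t
  discrete_right := h.discrete_right.mono fun _ hx => right_ne_zero_of_mul hx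
  tsum_fourier φ := by
    have h1 := h.tsum_fourier (𝓕⁻ ((𝓕 φ).compSubConstCLM ℂ (-t)))
    simp only [SchwartzMap.fourierInv_compSubConstCLM, FourierTransform.fourier_fourierInv_eq,
      FourierTransform.fourierInv_fourier_eq, SchwartzMap.compSubConstCLM_apply,
      sub_neg_eq_add, neg_mul] at h1
    rw [← (Equiv.addRight t).tsum_eq]
    simp only [Equiv.coe_addRight, add_sub_cancel_right]
    rw [h1]
    exact tsum_congr fun x => by ring

theorem modulate (h : CrystalPair u v) (s : ℝ) :
    CrystalPair (fun x => 𝐞 (s * x) * u x) (fun ξ => v (ξ - s)) where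
  slow_left := h.slow_left.of_norm_le (c := 1) fun x => by
    rw [norm_mul, Circle.norm_coe]
  slow_right := h.slow_right.comp_sub_const s
  discrete_left := h.discrete_left.mono fun _ hx => right_ne_zero_of_mul hx
  discrete_right := h.discrete_right.preimage_sub_const s
  tsum_fourier φ := by
    have h1 := h.tsum_fourier (φ.compSubConstCLM ℂ (-s))
    simp only [SchwartzMap.fourier_compSubConstCLM, SchwartzMap.compSubConstCLM_apply,
      sub_neg_eq_add, neg_mul, neg_neg] at h1
    rw [← (Equiv.addRight s).tsum_eq fun ξ => v (ξ - s) * φ ξ]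
    simp only [Equiv.coe_addRight, add_sub_cancel_right]
    rw [← h1]
    exact tsum_congr fun x => by ring

end CrystalPair

theorem isDiscreteSet_range_mul_intCast {a : ℝ} (ha : a ≠ 0) :
    IsDiscreteSet (range fun k : ℤ => a * k) := fun x r => by
  refine ((finite_Icc ⌈-((|x| + r) / |a|)⌉ ⌊(|x| + r) / |a|⌋).image fun k : ℤ => a * k).subset ?_
  rintro _ ⟨⟨k, rfl⟩, hk⟩
  refine ⟨k, ?_, rfl⟩
  rw [Metric.mem_ball, Real.dist_eq] at hk
  have h1 : |a * (k : ℝ)| < |x| + r := by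
    have := abs_sub_abs_le_abs_sub (a * k) x
    linarith
  rw [abs_mul, mul_comm, ← lt_div_iff₀ (abs_pos.2 ha), abs_lt] at h1
  exact ⟨Int.ceil_le.2 h1.1.le, Int.le_floor.2 h1.2.le⟩

/-- The weight function of the Dirac comb `∑ k : ℤ, δ_{a k}`. -/
noncomputable def combWeight (a : ℝ) : ℝ → ℂ := (range fun k : ℤ => a * k).indicator 1

theorem support_combWeight (a : ℝ) :
    Function.support (combWeight a) = range fun k : ℤ => a * k := by
  simp [combWeight]

theorem combWeight_mul_intCast (a : ℝ) (k : ℤ) : combWeight a (a * k) = 1 :=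
  indicator_of_mem (mem_range_self k) _

theorem injective_mul_intCast {a : ℝ} (ha : a ≠ 0) : Function.Injective fun k : ℤ => a * k :=
  (mul_right_injective₀ ha).comp Int.cast_injective

theorem tsum_combWeight_mul {a : ℝ} (ha : a ≠ 0) (f : ℝ → ℂ) :
    ∑' x, combWeight a x * f x = ∑' k : ℤ, f (a * k) := by
  rw [← (injective_mul_intCast ha).tsum_eq]
  · simp only [combWeight_mul_intCast, one_mul]
  · intro x hx
    rw [← support_combWeight]
    exact left_ne_zero_of_mul hx

theorem slowlyGrowing_combWeight {a : ℝ} (ha : a ≠ 0) : SlowlyGrowing (combWeight a) := by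
  refine ((injective_mul_intCast ha).summable_iff ?_).1 ?_
  · intro x hx
    rw [← support_combWeight, Function.notMem_support] at hx
    simp [hx]
  · simp only [Function.comp_def, combWeight_mul_intCast, norm_one, one_mul]
    have h : Summable fun k : ℤ => (a ^ 2)⁻¹ * (1 / (k : ℝ) ^ 2) :=
      (Real.summable_one_div_int_pow.2 one_lt_two).mul_left _
    refine Summable.of_norm_bounded_eventually h ?_
    filter_upwards [(Set.finite_singleton (0 : ℤ)).compl_mem_cofinite] with k hk
    have hk' : (k : ℝ) ≠ 0 := by simpa using hk
    rw [Real.norm_of_nonneg (by positivity), one_div, ← mul_inv, ← mul_pow]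
    gcongr
    linarith

/-- Poisson's summation formula: the Fourier transform of a Dirac comb is a multiple of the comb
with the reciprocal spacing. -/
theorem crystalPair_combWeight {a : ℝ} (ha : 0 < a) :
    CrystalPair (combWeight a⁻¹) fun ξ => a * combWeight a ξ where
  slow_left := slowlyGrowing_combWeight (inv_ne_zero ha.ne')
  slow_right := (slowlyGrowing_combWeight ha.ne').of_norm_le fun x => (norm_mul _ _).le
  discrete_left := by
    rw [support_combWeight]
    exact isDiscreteSet_range_mul_intCast (inv_ne_zero ha.ne')
  discrete_right := by
    refine IsDiscreteSet.mono (isDiscreteSet_range_mul_intCast ha.ne') fun x hx => ?_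
    rw [← support_combWeight]
    exact right_ne_zero_of_mul hx
  tsum_fourier φ := by
    let ψ : 𝓢(ℝ, ℂ) := SchwartzMap.compCLMOfContinuousLinearEquiv ℂ
      (ContinuousLinearEquiv.unitsEquivAut ℝ (Units.mk0 a ha.ne')) φ
    have hψ (x : ℝ) : ψ x = φ (a * x) := by
      rw [mul_comm]; rfl
    have hψF (ξ : ℝ) : 𝓕 ψ ξ = (a : ℂ)⁻¹ * 𝓕 φ (a⁻¹ * ξ) := by
      rw [SchwartzMap.fourier_coe, SchwartzMap.fourier_coe, Real.fourier_real_eq,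
        Real.fourier_real_eq]
      have := Measure.integral_comp_mul_left (fun y : ℝ => 𝐞 (-(y * (a⁻¹ * ξ))) • φ y) a
      rw [abs_of_pos (inv_pos.2 ha), Complex.real_smul, Complex.ofReal_inv] at this
      rw [← this]
      refine integral_congr_ae (.of_forall fun x => ?_)
      simp only [hψ]
      congr 3
      field_simp
    have hP := SchwartzMap.tsum_eq_tsum_fourier ψ 0
    simp only [zero_add, hψ, hψF, QuotientAddGroup.mk_zero, fourier_eval_zero, mul_one,
      tsum_mul_left] at hP
    simp only [mul_assoc, tsum_mul_left]
    rw [tsum_combWeight_mul (inv_ne_zero ha.ne'), tsum_combWeight_mul ha.ne', hP, ← mul_assoc,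
      mul_inv_cancel₀ (Complex.ofReal_ne_zero.2 ha.ne'), one_mul]

/-! ### Crystalline pairs vanishing on a large interval -/

theorem coe_fourierChar_eq_iff (x y : ℝ) :
    ((𝐞 x : Circle) : ℂ) = 𝐞 y ↔ ∃ n : ℤ, x = y + n := by
  rw [Real.fourierChar_apply, Real.fourierChar_apply, Complex.exp_eq_exp_iff_exists_int]
  refine exists_congr fun n => ?_
  have h2 : (2 * Real.pi * Complex.I : ℂ) ≠ 0 := Complex.two_pi_I_ne_zero
  constructor
  · intro h
    have h3 : (2 * Real.pi * Complex.I : ℂ) * (x : ℂ) =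
        2 * Real.pi * Complex.I * ((y + n : ℝ) : ℂ) := by
      push_cast at h ⊢
      linear_combination h
    exact_mod_cast mul_left_cancel₀ h2 h3
  · rintro rfl
    push_cast
    ring

theorem coe_fourierChar_ne {x y : ℝ} (hne : x ≠ y) (h : |x - y| < 1) :
    ((𝐞 x : Circle) : ℂ) ≠ 𝐞 y := by
  rw [Ne, coe_fourierChar_eq_iff]
  rintro ⟨n, hn⟩
  have h1 : x - y = n := by linarith
  rw [h1] at h
  have hn0 : n = 0 := Int.abs_lt_one_iff.1 (by exact_mod_cast h)
  exact hne (sub_eq_zero.1 (by rw [h1, hn0, Int.cast_zero]))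

namespace CrystalPair

variable {u v : ℝ → ℂ}

/-- Finitely many atoms `f ∈ F` can be removed by multiplying with low-frequency factors
`x ↦ 𝐞 (θ * x) - 𝐞 (θ * f)`; on the Fourier side atoms are displaced by less than `δ`. -/
theorem exists_eq_zero_on_finset (h : CrystalPair u v) (F : Finset ℝ) {y : ℝ} (hy : u y ≠ 0)
    (hyF : y ∉ F) {δ : ℝ} (hδ : 0 < δ) :
    ∃ u' v' : ℝ → ℂ, CrystalPair u' v' ∧ (∀ x, u x = 0 → u' x = 0) ∧ (∀ x ∈ F, u' x = 0) ∧
      u' y ≠ 0 ∧ ∀ ξ, v' ξ ≠ 0 → ∃ η, |η - ξ| < δ ∧ v η ≠ 0 := by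
  classical
  induction F using Finset.induction_on generalizing δ with
  | empty => exact ⟨u, v, h, fun _ => id, by simp, hy, fun ξ hξ => ⟨ξ, by simpa using hδ, hξ⟩⟩
  | insert f F hf ih =>
    obtain ⟨u', v', h', h1, h2, h3, h4⟩ :=
      ih (fun hF => hyF (Finset.mem_insert_of_mem hF)) (half_pos hδ)
    have hyf : y ≠ f := fun e => hyF (e ▸ Finset.mem_insert_self f F)
    have hd : 0 < |y - f| := abs_pos.2 (sub_ne_zero.2 hyf)
    -- `θ < δ / 2` controls the displacement; `θ * |y - f| < 1` keeps the atom at `y`.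
    obtain ⟨θ, hθ0, hθ⟩ := exists_between (lt_min (half_pos hδ) (inv_pos.2 hd))
    obtain ⟨hθδ, hθy⟩ := lt_min_iff.1 hθ
    refine ⟨_, _, (h'.modulate θ).add (h'.const_mul (-𝐞 (θ * f))), ?_, ?_, ?_, ?_⟩
    · intro x hx
      simp [h1 x hx]
    · intro x hx
      rcases Finset.mem_insert.1 hx with rfl | hx
      · ring
      · simp [h2 x hx]
    · rw [← add_mul, ← sub_eq_add_neg]
      refine mul_ne_zero (sub_ne_zero.2 (coe_fourierChar_ne ?_ ?_)) h3
      · exact fun e => hyf (mul_left_cancel₀ hθ0.ne' e)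
      · rw [← mul_sub, abs_mul, abs_of_pos hθ0]
        rwa [lt_inv_comm₀ hθ0 hd, ← one_div, lt_div_iff₀ hθ0, mul_comm] at hθy
    · intro ξ hξ
      by_cases hv : v' ξ = 0
      · have hv' : v' (ξ - θ) ≠ 0 := by
          intro e
          simp [hv, e] at hξ
        obtain ⟨η, hη, hvη⟩ := h4 _ hv'
        refine ⟨η, ?_, hvη⟩
        rw [abs_lt] at hη ⊢
        constructor <;> linarith
      · obtain ⟨η, hη, hvη⟩ := h4 _ hv
        exact ⟨η, by linarith, hvη⟩

end CrystalPair

/-- There are crystalline measures with rational atoms such that the measure and its Fourier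
transform both vanish on `[-n, n]`, while the measure has an atom at `n + 1`. -/
theorem exists_crystalPair_vanishing (n : ℕ) :
    ∃ u v : ℝ → ℂ, CrystalPair u v ∧ (∀ x, u x ≠ 0 → (n : ℝ) < |x|) ∧
      (∀ x, u x ≠ 0 → ∃ q : ℚ, x = q) ∧ (∀ ξ, v ξ ≠ 0 → (n : ℝ) < |ξ|) ∧ u (n + 1) ≠ 0 := by
  let a : ℝ := 2 * (n + 1)
  have ha : 0 < a := by positivity
  -- Modulation moves the atoms on the Fourier side to the odd multiples of `n + 1`.
  have h := (crystalPair_combWeight ha).modulate (n + 1)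
  have hu_supp (x : ℝ) : combWeight a⁻¹ x ≠ 0 ↔ ∃ k : ℤ, a⁻¹ * k = x := by
    rw [← Function.mem_support, support_combWeight]
    rfl
  have hfin := h.discrete_left 0 (n + 1)
  have hy : (𝐞 (((n : ℝ) + 1) * (n + 1)) : ℂ) * combWeight a⁻¹ (n + 1) ≠ 0 := by
    refine mul_ne_zero (Circle.coe_ne_zero _) ((hu_supp _).2 ⟨2 * (n + 1) * (n + 1), ?_⟩)
    push_cast
    simp only [a]
    field_simp
  have hyF : ((n : ℝ) + 1) ∉ hfin.toFinset := by
    rw [Set.Finite.mem_toFinset]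
    rintro ⟨-, hb⟩
    rw [mem_ball_zero_iff, Real.norm_of_nonneg (by positivity)] at hb
    exact lt_irrefl _ hb
  obtain ⟨u, v, huv, h1, h2, h3, h4⟩ := h.exists_eq_zero_on_finset hfin.toFinset hy hyF one_pos
  have h1' (x : ℝ) (hx : u x ≠ 0) :
      (𝐞 (((n : ℝ) + 1) * x) : ℂ) * combWeight a⁻¹ x ≠ 0 := fun e => hx (h1 x e)
  refine ⟨u, v, huv, fun x hx => ?_, fun x hx => ?_, fun ξ hξ => ?_, h3⟩
  · by_contra hle
    refine hx (h2 x (hfin.mem_toFinset.2 ⟨h1' x hx, ?_⟩))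
    rw [mem_ball_zero_iff, Real.norm_eq_abs]
    linarith [not_lt.1 hle]
  · obtain ⟨k, rfl⟩ := (hu_supp x).1 (right_ne_zero_of_mul (h1' x hx))
    exact ⟨(2 * ((n : ℚ) + 1))⁻¹ * k, by push_cast; rfl⟩
  · obtain ⟨η, hη, hvη⟩ := h4 ξ hξ
    have hk : combWeight a (η - (n + 1)) ≠ 0 := right_ne_zero_of_mul hvη
    rw [← Function.mem_support, support_combWeight] at hk
    obtain ⟨k, hk⟩ := hk
    have hη' : η = (n + 1) * ((2 * k + 1 : ℤ) : ℝ) := by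
      push_cast
      simp only [a] at hk
      linear_combination -hk
    have hodd : (1 : ℝ) ≤ |((2 * k + 1 : ℤ) : ℝ)| := by
      rw [← Int.cast_abs]
      exact_mod_cast Int.one_le_abs (by omega)
    have hbig : (n : ℝ) + 1 ≤ |η| := by
      rw [hη', abs_mul, abs_of_pos (by positivity : (0 : ℝ) < n + 1)]
      exact le_mul_of_one_le_right (by positivity) hodd
    have := abs_sub_abs_le_abs_sub η ξ
    linarith

/-- The pairs of `exists_crystalPair_vanishing`, rescaled so that the masses are summable in `n`. -/
theorem exists_crystalPair_vanishing_tsum_le (n : ℕ) :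
    ∃ u v : ℝ → ℂ, CrystalPair u v ∧ (∀ x, u x ≠ 0 → (n : ℝ) < |x|) ∧
      (∀ x, u x ≠ 0 → ∃ q : ℚ, x = q) ∧ (∀ ξ, v ξ ≠ 0 → (n : ℝ) < |ξ|) ∧ u (n + 1) ≠ 0 ∧
      ∑' x, ‖u x‖ * (1 + x ^ 2)⁻¹ ≤ (1 / 2) ^ n := by
  obtain ⟨u, v, h, h1, h2, h3, h4⟩ := exists_crystalPair_vanishing n
  set S := ∑' x, ‖u x‖ * (1 + x ^ 2)⁻¹ with hS
  have hS0 : 0 ≤ S := tsum_nonneg fun x => by positivity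
  let c : ℝ := (1 / 2) ^ n / (S + 1)
  have hc : 0 < c := by positivity
  refine ⟨_, _, h.const_mul c, fun x hx => h1 x (right_ne_zero_of_mul hx),
    fun x hx => h2 x (right_ne_zero_of_mul hx), fun x hx => h3 x (right_ne_zero_of_mul hx),
    mul_ne_zero (Complex.ofReal_ne_zero.2 hc.ne') h4, ?_⟩
  simp only [norm_mul, Complex.norm_real, Real.norm_of_nonneg hc.le, mul_assoc, tsum_mul_left]
  rw [← hS, div_mul_eq_mul_div, div_le_iff₀ (by positivity)]
  gcongr
  linarith

/-! ### Series of difference quotients -/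

/-- Difference quotients of a Schwartz function with steps in `(0, 1]` are controlled by one
Schwartz seminorm, uniformly in the step. -/
theorem SchwartzMap.exists_norm_sub_div_le :
    ∃ (s : Finset (ℕ × ℕ)) (C : ℝ), 0 ≤ C ∧ ∀ (φ : 𝓢(ℝ, ℂ)) (x ε : ℝ), 0 < ε → ε ≤ 1 →
      ‖(φ x - φ (x + ε)) / ε‖ ≤ C * s.sup (schwartzSeminormFamily ℂ ℝ ℂ) φ * (1 + x ^ 2)⁻¹ := by
  refine ⟨Finset.Iic (2, 1), 16, by norm_num, fun φ x ε hε hε1 => ?_⟩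
  set p := (Finset.Iic (2, 1)).sup (schwartzSeminormFamily ℂ ℝ ℂ) φ with hp
  have hp0 : 0 ≤ p := apply_nonneg _ _
  have hderiv (y : ℝ) (hy : y ∈ Icc x (x + ε)) : ‖deriv φ y‖ ≤ 16 * p * (1 + x ^ 2)⁻¹ := by
    have h1 := SchwartzMap.one_add_le_sup_seminorm_apply (𝕜 := ℂ) (m := (2, 1)) (k := 2) (n := 1)
      le_rfl le_rfl φ y
    rw [norm_iteratedFDeriv_eq_norm_iteratedDeriv, iteratedDeriv_one] at h1
    replace h1 : (1 + ‖y‖) ^ 2 * ‖deriv φ y‖ ≤ 4 * p := by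
      refine h1.trans_eq ?_
      rw [hp]
      norm_num
      rfl
    rw [← div_eq_mul_inv, le_div_iff₀ (by positivity)]
    have h2 : 1 + x ^ 2 ≤ 4 * (1 + ‖y‖) ^ 2 := by
      have h3 := one_add_sq_add_le y (x - y)
      have h4 : (x - y) ^ 2 ≤ 1 := by
        rw [sq_le_one_iff_abs_le_one, abs_le]
        constructor <;> linarith [hy.1, hy.2]
      have h5 : 1 + y ^ 2 ≤ (1 + ‖y‖) ^ 2 := by
        rw [Real.norm_eq_abs, ← sq_abs y]
        nlinarith [abs_nonneg y]
      have h6 : 1 + y ^ 2 ≥ 0 := by positivity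
      rw [add_sub_cancel] at h3
      nlinarith
    calc ‖deriv φ y‖ * (1 + x ^ 2) ≤ ‖deriv φ y‖ * (4 * (1 + ‖y‖) ^ 2) := by gcongr
      _ = 4 * ((1 + ‖y‖) ^ 2 * ‖deriv φ y‖) := by ring
      _ ≤ 16 * p := by linarith
  have hmv := Convex.norm_image_sub_le_of_norm_deriv_le (f := φ) (s := Icc x (x + ε))
    (x := x) (y := x + ε) (fun y _ => φ.differentiableAt) hderiv (convex_Icc _ _)
    (by simp [hε.le]) (by simp [hε.le])
  rw [norm_div, Complex.norm_real, Real.norm_of_nonneg hε.le, div_le_iff₀ hε, norm_sub_rev]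
  simpa [abs_of_pos hε] using hmv

/-- The difference quotient of a weight function: the atom `u x • δ_x` is replaced by
`(u x / ε) • (δ_x - δ_{x + ε})`. -/
noncomputable def diffQuot (ε : ℝ) (u : ℝ → ℂ) (x : ℝ) : ℂ := (u x - u (x - ε)) / ε

theorem tsum_diffQuot_mul {u : ℝ → ℂ} (hu : SlowlyGrowing u) (ε : ℝ) (φ : 𝓢(ℝ, ℂ)) :
    ∑' x, diffQuot ε u x * φ x = ∑' x, u x * ((φ x - φ (x + ε)) / ε) := by
  have h1 := hu.summable_mul φ
  have h2 := (hu.comp_sub_const ε).summable_mul φ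
  have h3 := hu.summable_mul (φ.compSubConstCLM ℂ (-ε))
  simp only [SchwartzMap.compSubConstCLM_apply, sub_neg_eq_add] at h3
  have h4 : ∑' x, u (x - ε) * φ x = ∑' x, u x * φ (x + ε) := by
    rw [← (Equiv.addRight ε).tsum_eq]
    simp
  calc ∑' x, diffQuot ε u x * φ x = (∑' x, (u x * φ x - u (x - ε) * φ x)) / ε := by
        rw [← tsum_div_const]
        exact tsum_congr fun x => by rw [diffQuot]; ring
    _ = (∑' x, (u x * φ x - u x * φ (x + ε))) / ε := by
        rw [h1.tsum_sub h2, h1.tsum_sub h3, h4]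
    _ = _ := by
        rw [← tsum_div_const]
        exact tsum_congr fun x => by ring

theorem CrystalPair.diffQuot {u v : ℝ → ℂ} (h : CrystalPair u v) (ε : ℝ) :
    CrystalPair (diffQuot ε u) fun ξ => (ε : ℂ)⁻¹ * (v ξ + -1 * (𝐞 (-(ε * ξ)) * v ξ)) := by
  have := (h.add ((h.translate ε).const_mul (-1))).const_mul (ε : ℂ)⁻¹
  convert this using 2 with x
  rw [_root_.diffQuot]
  ring

/-- Dividing by arbitrarily small steps `ε n` costs nothing on the level of distributions: the
series of difference quotients converges in the space of tempered distributions. -/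
theorem exists_temperedDistribution_tsum_diffQuot {u : ℕ → ℝ → ℂ} {ε : ℕ → ℝ}
    (hu : ∀ n, SlowlyGrowing (u n)) (hsum : ∀ n, ∑' x, ‖u n x‖ * (1 + x ^ 2)⁻¹ ≤ (1 / 2) ^ n)
    (hε : ∀ n, 0 < ε n) (hε1 : ∀ n, ε n ≤ 1) :
    ∃ T : 𝓢'(ℝ, ℂ), ∀ φ : 𝓢(ℝ, ℂ), T φ = ∑' n, ∑' x, diffQuot (ε n) (u n) x * φ x := by
  obtain ⟨s, C, hC0, hC⟩ := SchwartzMap.exists_norm_sub_div_le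
  let w (z : ℕ × ℝ) : ℝ := ‖u z.1 z.2‖ * (1 + z.2 ^ 2)⁻¹
  have hw : Summable w := by
    refine (summable_prod_of_nonneg fun z => by positivity).2 ⟨hu, ?_⟩
    exact Summable.of_nonneg_of_le (fun n => tsum_nonneg fun x => by positivity) hsum
      summable_geometric_two
  let A (φ : 𝓢(ℝ, ℂ)) (z : ℕ × ℝ) : ℂ := u z.1 z.2 * ((φ z.2 - φ (z.2 + ε z.1)) / ε z.1)
  have hA (φ : 𝓢(ℝ, ℂ)) (z : ℕ × ℝ) :
      ‖A φ z‖ ≤ C * s.sup (schwartzSeminormFamily ℂ ℝ ℂ) φ * w z := by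
    rw [norm_mul]
    calc _ ≤ ‖u z.1 z.2‖ * (C * s.sup (schwartzSeminormFamily ℂ ℝ ℂ) φ * (1 + z.2 ^ 2)⁻¹) := by
          gcongr
          exact hC φ z.2 (ε z.1) (hε _) (hε1 _)
      _ = _ := by ring
  have hAs (φ : 𝓢(ℝ, ℂ)) : Summable (A φ) := .of_norm_bounded (hw.mul_left _) (hA φ)
  let T : 𝓢(ℝ, ℂ) →L[ℂ] ℂ := SchwartzMap.mkCLMtoNormedSpace (fun φ => ∑' z, A φ z)
    (fun φ ψ => by
      rw [← (hAs φ).tsum_add (hAs ψ)]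
      refine tsum_congr fun z => ?_
      simp only [A, add_apply]
      ring)
    (fun a φ => by
      rw [RingHom.id_apply, smul_eq_mul, ← tsum_mul_left]
      refine tsum_congr fun z => ?_
      simp only [A, smul_apply, smul_eq_mul]
      ring)
    ⟨s, C * ∑' z, w z, mul_nonneg hC0 (tsum_nonneg fun z => by positivity), fun φ => by
      refine (tsum_of_norm_bounded (hw.mul_left _).hasSum (hA φ)).trans_eq ?_
      rw [tsum_mul_left]
      ring⟩
  refine ⟨ContinuousLinearMap.toPointwiseConvergenceCLM _ _ _ _ T, fun φ => ?_⟩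
  calc T φ = ∑' n, ∑' x, A φ (n, x) := (hAs φ).tsum_prod
    _ = _ := tsum_congr fun n => (tsum_diffQuot_mul (hu n) (ε n) φ).symm

/-! ### Locally finite sums of weight functions -/

section LocallyFinite

variable {w : ℕ → ℝ → ℂ}

theorem finite_setOf_ne_zero_of_lt_abs (hd : ∀ n, IsDiscreteSet (Function.support (w n)))
    (hw : ∀ n x, w n x ≠ 0 → (n : ℝ) < |x| + 1) {B : Set ℝ} (hB : IsBounded B) :
    {z : ℕ × ℝ | w z.1 z.2 ≠ 0 ∧ z.2 ∈ B}.Finite := by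
  obtain ⟨r, hr⟩ := hB.subset_ball 0
  have hfin : (⋃ n ∈ Finset.range ⌈r + 1⌉₊,
      Prod.mk n '' (Function.support (w n) ∩ B)).Finite :=
    Set.Finite.biUnion (Finset.finite_toSet _) fun n _ => ((hd n).finite_inter hB).image _
  refine hfin.subset ?_
  rintro ⟨n, x⟩ ⟨hx, hxB⟩
  have hxr := hr hxB
  rw [mem_ball_zero_iff, Real.norm_eq_abs] at hxr
  refine mem_iUnion₂.2 ⟨n, Finset.mem_range.2 (Nat.lt_ceil.2 ?_), x, ⟨hx, hxB⟩, rfl⟩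
  linarith [hw n x hx]

theorem isDiscreteSet_support_tsum (hd : ∀ n, IsDiscreteSet (Function.support (w n)))
    (hw : ∀ n x, w n x ≠ 0 → (n : ℝ) < |x| + 1) :
    IsDiscreteSet (Function.support fun x => ∑' n, w n x) := by
  intro c r
  refine ((finite_setOf_ne_zero_of_lt_abs hd hw (B := Metric.ball c r)
    Metric.isBounded_ball).image Prod.snd).subset ?_
  rintro x ⟨hx, hxr⟩
  obtain ⟨n, hn⟩ : ∃ n, w n x ≠ 0 := by
    by_contra! h
    exact hx (by simp [h])
  exact ⟨(n, x), ⟨hn, hxr⟩, rfl⟩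

/-- A tempered distribution given by a locally finite series of atomic measures is represented by
the sum of these measures. -/
theorem represents_ofWeights_tsum (hd : ∀ n, IsDiscreteSet (Function.support (w n)))
    (hw : ∀ n x, w n x ≠ 0 → (n : ℝ) < |x| + 1) {T : 𝓢'(ℝ, ℂ)}
    (hT : ∀ φ : 𝓢(ℝ, ℂ), T φ = ∑' n, ∑' x, w n x * φ x) :
    (LocalComplexMeasure.ofWeights _ (isDiscreteSet_support_tsum hd hw)).Represents T := by
  intro φ hφ
  rw [LocalComplexMeasure.integral_ofWeights, hT]
  have hs : Summable (Function.uncurry fun (n : ℕ) (x : ℝ) => w n x * φ x) := by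
    refine summable_of_hasFiniteSupport
      ((finite_setOf_ne_zero_of_lt_abs hd hw hφ.isCompact.isBounded).subset ?_)
    rintro ⟨n, x⟩ h
    exact ⟨left_ne_zero_of_mul h, subset_tsupport _ (right_ne_zero_of_mul h)⟩
  rw [← hs.tsum_comm]
  exact tsum_congr fun x => tsum_mul_right

end LocallyFinite

/-! ### Crystalline measures whose variation is not tempered -/

/-- Difference quotients with generic steps do not cancel each other. -/
theorem tsum_diffQuot_add_step {u : ℕ → ℝ → ℂ} {ε : ℕ → ℝ}
    (hu : ∀ n x, u n x ≠ 0 → ∃ q : ℚ, x = q) (hε : ∀ n, Irrational (ε n))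
    (hεε : ∀ m n, m ≠ n → Irrational (ε n - ε m)) (n : ℕ) (q : ℚ) :
    ∑' m, diffQuot (ε m) (u m) (q + ε n) = -u n q / ε n := by
  have h0 (m : ℕ) {t : ℝ} (ht : Irrational t) : u m (q + t) = 0 := by
    by_contra h
    obtain ⟨r, hr⟩ := hu m _ h
    exact (ht.ratCast_add q).ne_rat r hr
  rw [tsum_eq_single n]
  · rw [diffQuot, h0 n (hε n), add_sub_cancel_right, zero_sub]
  · intro m hm
    rw [diffQuot, h0 m (hε n), add_sub_assoc, h0 m (hεε m n hm), sub_zero, zero_div]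

/-- Steps as small as desired which are irrational and have irrational differences. -/
theorem exists_irrational_steps (b : ℕ → ℝ) (hb : ∀ n, 0 < b n) :
    ∃ ε : ℕ → ℝ, (∀ n, 0 < ε n) ∧ (∀ n, ε n ≤ b n) ∧ (∀ n, Irrational (ε n)) ∧
      ∀ m n, m ≠ n → Irrational (ε n - ε m) := by
  have hev (n : ℕ) : ∀ᶠ k : ℕ in Filter.atTop, 0 < k ∧ √2 / k ≤ b n := by
    refine (Filter.eventually_gt_atTop 0).and ?_
    exact (tendsto_const_div_atTop_nhds_zero_nat √2).eventually_le_const (hb n)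
  obtain ⟨k, hk, hkb⟩ := Filter.extraction_forall_of_eventually hev
  refine ⟨fun n => √2 / k n, fun n => ?_, fun n => (hkb n).2, fun n => ?_, fun m n hmn => ?_⟩
  · have := (hkb n).1
    positivity
  · exact irrational_sqrt_two.div_natCast (hkb n).1.ne'
  · have hq : ((k n : ℚ)⁻¹ - (k m : ℚ)⁻¹) ≠ 0 := by
      rw [Ne, sub_eq_zero, inv_inj, Nat.cast_inj]
      exact fun e => hmn (hk.injective e.symm)
    have := irrational_sqrt_two.mul_ratCast hq
    convert this using 1
    push_cast
    ring

theorem mainTheorem1 :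
    ∃ μ : LocalComplexMeasure,
      μ.IsCrystalline ∧ ¬ IsTemperedMeasure μ.variation ∧ ¬ μ.IsFourierQuasicrystal := by
  choose u v huv hu hrat hv hne hsum using exists_crystalPair_vanishing_tsum_le
  -- The steps are so small that the atom at `n + 1 + ε n` has mass at least `(n + 3) ^ n`.
  let b (n : ℕ) : ℝ := min 1 (‖u n (n + 1)‖ / (n + 3) ^ n)
  have hb (n : ℕ) : 0 < b n := lt_min one_pos (div_pos (norm_pos_iff.2 (hne n)) (by positivity))
  obtain ⟨ε, hε0, hεb, hεi, hεd⟩ := exists_irrational_steps b hb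
  have hε1 (n : ℕ) : ε n ≤ 1 := (hεb n).trans (min_le_left _ _)
  have hp (n : ℕ) := (huv n).diffQuot (ε n)
  obtain ⟨T, hT⟩ :=
    exists_temperedDistribution_tsum_diffQuot (fun n => (huv n).slow_left) hsum hε0 hε1
  have hpw (n : ℕ) (x : ℝ) (hx : diffQuot (ε n) (u n) x ≠ 0) : (n : ℝ) < |x| + 1 := by
    by_cases hux : u n x = 0
    · have hux' : u n (x - ε n) ≠ 0 := fun e => hx (by simp [diffQuot, hux, e])
      have h1 := hu n _ hux'
      have h2 := abs_sub x (ε n)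
      rw [abs_of_pos (hε0 n)] at h2
      linarith [hε1 n]
    · linarith [hu n x hux]
  have hqw (n : ℕ) (ξ : ℝ)
      (hξ : (ε n : ℂ)⁻¹ * (v n ξ + -1 * (𝐞 (-(ε n * ξ)) * v n ξ)) ≠ 0) : (n : ℝ) < |ξ| + 1 := by
    have hvξ : v n ξ ≠ 0 := fun e => hξ (by simp [e])
    linarith [hv n ξ hvξ]
  have hμ := represents_ofWeights_tsum (fun n => (hp n).discrete_left) hpw hT
  have hν := represents_ofWeights_tsum (fun n => (hp n).discrete_right) hqw (T := 𝓕 T) fun φ => by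
    rw [TemperedDistribution.fourier_apply, hT]
    exact tsum_congr fun n => (hp n).tsum_fourier φ
  set μ := LocalComplexMeasure.ofWeights _
    (isDiscreteSet_support_tsum (fun n => (hp n).discrete_left) hpw) with hμdef
  have hnt : ¬ IsTemperedMeasure μ.variation := by
    intro htemp
    have hfin (B : Set ℝ) (hB : IsBounded B) : μ.variation B < ∞ :=
      LocalComplexMeasure.variation_ofWeights_lt_top hB
    obtain ⟨K, C, hKC⟩ := htemp.exists_real_singleton_le hfin
    have hbound (n : ℕ) : ((n : ℝ) + 3) ^ n ≤ max C 0 * ((n : ℝ) + 3) ^ K := by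
      have hatom : ‖μ {(n : ℝ) + 1 + ε n}‖ = ‖u n (n + 1)‖ / ε n := by
        have h1 := tsum_diffQuot_add_step hrat hεi hεd n (n + 1)
        push_cast at h1
        rw [hμdef, LocalComplexMeasure.ofWeights_singleton, h1, norm_div, norm_neg,
          Complex.norm_real, Real.norm_of_nonneg (hε0 n).le]
      have hvar : ‖μ {(n : ℝ) + 1 + ε n}‖ ≤ μ.variation.real {(n : ℝ) + 1 + ε n} := by
        rw [← toReal_enorm]
        exact ENNReal.toReal_mono (hfin _ isBounded_singleton).ne
          (μ.enorm_le_variation (measurableSet_singleton _))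
      have habs : 1 + |(n : ℝ) + 1 + ε n| ≤ n + 3 := by
        rw [abs_of_pos (by linarith [hε0 n, n.cast_nonneg (α := ℝ)])]
        linarith [hε1 n]
      calc ((n : ℝ) + 3) ^ n ≤ ‖u n (n + 1)‖ / ε n := by
            rw [le_div_comm₀ (by positivity) (hε0 n)]
            exact (hεb n).trans (min_le_right _ _)
        _ ≤ C * (1 + |(n : ℝ) + 1 + ε n|) ^ K := hatom ▸ hvar.trans (hKC _)
        _ ≤ max C 0 * ((n : ℝ) + 3) ^ K := by
            gcongr
            exact le_max_left _ _
    obtain ⟨N, hN⟩ := exists_nat_gt (max C 0)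
    have h1 := hbound (N + K)
    rw [pow_add] at h1
    have h2 := le_of_mul_le_mul_right h1 (by positivity)
    have h3 : N < (((N + K : ℕ) : ℝ) + 3) ^ N := by
      calc (N : ℝ) < 2 ^ N := by exact_mod_cast N.lt_two_pow_self
        _ ≤ (((N + K : ℕ) : ℝ) + 3) ^ N := by
            gcongr
            linarith [(N + K).cast_nonneg (α := ℝ)]
    linarith
  refine ⟨μ, ⟨LocalComplexMeasure.isDiscreteSet_support_ofWeights, _, ⟨T, hμ, hν⟩,
    LocalComplexMeasure.isDiscreteSet_support_ofWeights⟩, hnt, fun h => hnt h.2.1⟩
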